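/- Let $\mathfrak C_d$ be the set of non-empty compact subsets of $\mathbb R^d$. Let $(\Omega_0,\mathcal F_0,P)$ be a non-atomic probability space and $R:\Omega_0\to\mathfrak C_d$ a measurable multifunction (i.e. $\{\omega: R(\omega)\cap O\neq\emptyset\}\in\mathcal F_0$ for every open $O\subset\mathbb R^d$) with $\mathbb E\|R\|<\infty$, where $\|C\|=\sup_{x\in C}\|x\|$. On a probability space $(\Omega,\mathcal F,\mu)$ let $R_1,R_2,\dots$ be i.i.d. random sets with the distribution of $R$, and let $Q_{0,n}$, $n\ge 1$, be $\mathbb R^d$-valued with $Q_{0,n}/n\to q_0$ almost surely for some fixed $q_0\in\mathbb R^d$. Let $\rho:\mathbb R^d\to\mathbb R$ be convex with $\rho(\alpha q)=\alpha\rho(q)$ for all $\alpha\ge 0$, $q\in\mathbb R^d$, and let $\mathcal P=\{z\in\mathbb R^d: z\cdot q\le\rho(q)\ \text{for all } q\in\mathbb R^d\}$. Write $\mathbb E[R]=\{\mathbb E[X]: X \text{ an integrable random vector on }\Omega_0 \text{ with } X\in R \text{ a.s.}\}$, $h(z;C)=\inf_{q\in C} q\cdot z$, $H(z)=h(z;\mathbb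 E[R])$, and $\widehat H_n(z)=\frac1n\sum_{i=1}^n h(z;R_i)$. Let $$\mathsf R^{\mathsf{DM}}=\max\{H(z)-z\cdot q_0: z\in\mathcal P\},\qquad \Theta(z)=\{q\in\mathbb E[R]: q\cdot z=H(z)\}.$$ The maximum is attained, and $\Theta(z)\ne\emptyset$ for every $z\in\mathbb R^d$. For a choice $\bar q(z)\in\Theta(z)$ (the unique element of $\Theta(z)$ when $H$ is differentiable at $z$), the mean-field suboptimality gap of the price $z$ is $$\Delta(z)=z\cdot(\bar q(z)-q_0)-\mathsf R^{\mathsf{DM}}.$$ Theorem. Let $\hat z_n$, $n\ge1$, be any sequence of (random) prices such that almost surely, for every $n\ge 1$, $$\hat z_n\in\operatorname{argmax}\{\widehat H_n(z)-z\cdot Q_{0,n}/n: z\in\mathcal P\}.$$ Then, for any choice of $\bar q(\hat z_n)\in\Theta(\hat z_n)$, $\lim_{n\to\infty}\Delta(\hat z_n)=0$ almost surely; in this sense the empirically optimized prices are asymptotically optimal. -/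

import Mathlib

open MeasureTheory ProbabilityTheory TopologicalSpace Filter Topology

noncomputable section

namespace DemandResponse

/-- Energy profiles (and price vectors) over `d` time periods: Euclidean space `ℝ^d`. -/
abbrev Profile (d : ℕ) : Type := EuclideanSpace ℝ (Fin d)

/-- The space `𝔠_d` of non-empty compact subsets of `ℝ^d`. -/
abbrev CompactSets (d : ℕ) : Type := NonemptyCompacts (Profile d)

/-- The Effros σ-algebra on `𝔠_d`, generated by the events "the set hits `O`", `O` open.
The law of a random set is a measure on this σ-algebra. -/
instance instMeasurableSpaceCompactSets (d : ℕ) : MeasurableSpace (CompactSets d) :=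
  MeasurableSpace.generateFrom
    {A | ∃ O : Set (Profile d), IsOpen O ∧
      A = {C : CompactSets d | ((C : Set (Profile d)) ∩ O).Nonempty}}

/-- A multifunction `R : Ω ⇉ ℝ^d` with non-empty compact values is measurable if
`{ω | R ω ∩ O ≠ ∅}` is measurable for every open `O`. -/
def MeasurableMultifunction {d : ℕ} {Ω : Type*} [MeasurableSpace Ω]
    (R : Ω → CompactSets d) : Prop :=
  ∀ O : Set (Profile d), IsOpen O →
    MeasurableSet {ω | ((R ω : Set (Profile d)) ∩ O).Nonempty}

/-- Measurability of a multifunction is measurability for the Effros σ-algebra. -/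
theorem measurableMultifunction_iff {d : ℕ} {Ω : Type*} [MeasurableSpace Ω]
    (R : Ω → CompactSets d) : MeasurableMultifunction R ↔ Measurable R := by
  constructor
  · intro h
    refine measurable_generateFrom ?_
    rintro A ⟨O, hO, rfl⟩
    exact h O hO
  · intro h O hO
    exact h (MeasurableSpace.measurableSet_generateFrom ⟨O, hO, rfl⟩)

/-- A measure without atoms: every measurable set of positive measure has a measurable subset of
strictly smaller positive measure. -/
def NonAtomic {Ω : Type*} [MeasurableSpace Ω] (P : Measure Ω) : Prop :=
  ∀ A : Set Ω, MeasurableSet A → 0 < P A →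
    ∃ B : Set Ω, MeasurableSet B ∧ B ⊆ A ∧ 0 < P B ∧ P B < P A

/-- The norm `‖C‖ = sup {‖x‖ : x ∈ C}` of a non-empty compact set. -/
def setNorm {d : ℕ} (C : CompactSets d) : ℝ :=
  sSup ((fun x : Profile d => ‖x‖) '' (C : Set (Profile d)))

/-- `X` is a selection of the random set `R`: an integrable random vector with `X ∈ R` a.s. -/
def IsSelection {d : ℕ} {Ω : Type*} [MeasurableSpace Ω] (P : Measure Ω)
    (R : Ω → CompactSets d) (X : Ω → Profile d) : Prop :=
  Measurable X ∧ Integrable X P ∧ ∀ᵐ ω ∂P, X ω ∈ (R ω : Set (Profile d))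

/-- The expectation `𝔼[R] = {𝔼[X] : X is a selection of R}` of a random set. -/
def expectedSet {d : ℕ} {Ω : Type*} [MeasurableSpace Ω] (P : Measure Ω)
    (R : Ω → CompactSets d) : Set (Profile d) :=
  {q | ∃ X : Ω → Profile d, IsSelection P R X ∧ q = ∫ ω, X ω ∂P}

/-- The user cost `h(p; C) = min {q · p : q ∈ C}`. -/
def userCost {d : ℕ} (p : Profile d) (C : Set (Profile d)) : ℝ :=
  sInf ((fun q : Profile d => inner ℝ q p) '' C)

/-- The mean-field cost `H(p) = h(p; 𝔼[R])`. -/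
def meanFieldCost {d : ℕ} {Ω : Type*} [MeasurableSpace Ω] (P : Measure Ω)
    (R : Ω → CompactSets d) (p : Profile d) : ℝ :=
  userCost p (expectedSet P R)

/-- The empirical mean cost `Ĥ_n(p) = (1/n) ∑_{i<n} h(p; R_i)`. -/
def empiricalCost {d : ℕ} (n : ℕ) (R : ℕ → CompactSets d) (p : Profile d) : ℝ :=
  (1 / (n : ℝ)) * ∑ i ∈ Finset.range n, userCost p (R i : Set (Profile d))

/-- The price set `𝒫 = {z : z · q ≤ ρ q for all q}`. -/
def priceSet {d : ℕ} (ρ : Profile d → ℝ) : Set (Profile d) :=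
  {z | ∀ q : Profile d, inner ℝ z q ≤ ρ q}

/-- The mean-field cost of direct control, `R^DM = max {H(z) - z · q₀ : z ∈ 𝒫}`. -/
def directCost {d : ℕ} {Ω : Type*} [MeasurableSpace Ω] (P : Measure Ω)
    (R : Ω → CompactSets d) (ρ : Profile d → ℝ) (q₀ : Profile d) : ℝ :=
  sSup ((fun z : Profile d => meanFieldCost P R z - inner ℝ z q₀) '' priceSet ρ)

/-- The set `Θ(z)` of optimal average consumption profiles at price `z`, i.e. the minimizers of
`z · q` over `q ∈ 𝔼[R]`. Where `H` is differentiable, its only element is `q̄(z)`. -/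
def optimalProfiles {d : ℕ} {Ω : Type*} [MeasurableSpace Ω] (P : Measure Ω)
    (R : Ω → CompactSets d) (z : Profile d) : Set (Profile d) :=
  {q | q ∈ expectedSet P R ∧ inner ℝ q z = userCost z (expectedSet P R)}

/-- The mean-field suboptimality gap `Δ(z) = z · (q̄ - q₀) - R^DM` of the price `z`, where
`q̄ ∈ Θ(z)` is the average consumption at the price `z`. -/
def suboptimalityGap {d : ℕ} {Ω : Type*} [MeasurableSpace Ω] (P : Measure Ω)
    (R : Ω → CompactSets d) (ρ : Profile d → ℝ) (q₀ z q : Profile d) : ℝ :=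
  inner ℝ z (q - q₀) - directCost P R ρ q₀

end DemandResponse

end

namespace DemandResponse

/-! ### Measurable selection of minimizers -/

section ArgminSelection

variable {d : ℕ} {Ω : Type*} [MeasurableSpace Ω]

/-- The points of `K` that minimize `⟨·, v⟩` over `K`. -/
def argminSet (v : Profile d) (K : Set (Profile d)) : Set (Profile d) :=
  {x | x ∈ K ∧ ∀ y ∈ K, (inner ℝ x v : ℝ) ≤ inner ℝ y v}

theorem argminSet_nonempty (v : Profile d) {K : Set (Profile d)} (hK : IsCompact K)
    (hne : K.Nonempty) : (argminSet v K).Nonempty := by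
  obtain ⟨x, hx, hmin⟩ := hK.exists_isMinOn hne
    (f := fun x : Profile d => (inner ℝ x v : ℝ)) (by fun_prop)
  exact ⟨x, hx, fun y hy => hmin hy⟩

theorem isCompact_argminSet (v : Profile d) {K : Set (Profile d)} (hK : IsCompact K) :
    IsCompact (argminSet v K) := by
  have : argminSet v K
      = K ∩ ⋂ y ∈ K, {x : Profile d | (inner ℝ x v : ℝ) ≤ inner ℝ y v} := by
    ext x; simp [argminSet]
  rw [this]
  refine hK.inter_right (isClosed_biInter fun y _ => ?_)
  exact isClosed_le (by fun_prop) (by fun_prop)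

/-- A minimizer lies in `F` exactly when the minimum over `K ∩ F` does not exceed that over `K`.
Rational thresholds turn this comparison into countably many hitting conditions. -/
theorem argminSet_inter_nonempty_iff (v : Profile d) {K F : Set (Profile d)} (hK : IsCompact K)
    (hne : K.Nonempty) (hF : IsClosed F) :
    (argminSet v K ∩ F).Nonempty ↔ ∀ r : ℚ,
      (K ∩ {x | (inner ℝ x v : ℝ) ≤ r}).Nonempty →
        (K ∩ (F ∩ {x | (inner ℝ x v : ℝ) ≤ r})).Nonempty := by
  constructor
  · rintro ⟨x, ⟨hxK, hx⟩, hxF⟩ r ⟨y, hyK, hy⟩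
    exact ⟨x, hxK, hxF, (hx y hyK).trans hy⟩
  · intro h
    obtain ⟨m, hmK, hm⟩ := argminSet_nonempty v hK hne
    obtain ⟨r₀, hr₀⟩ := exists_rat_gt (inner ℝ m v : ℝ)
    obtain ⟨x₀, hx₀K, hx₀F, -⟩ := h r₀ ⟨m, hmK, hr₀.le⟩
    obtain ⟨x, hx, hxmin⟩ := argminSet_nonempty v (hK.inter_right hF) ⟨x₀, hx₀K, hx₀F⟩
    refine ⟨x, ⟨hx.1, fun y hy => le_trans ?_ (hm y hy)⟩, hx.2⟩
    by_contra hlt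
    obtain ⟨r, hr1, hr2⟩ := exists_rat_btwn (not_le.mp hlt)
    obtain ⟨w, hwK, hwF, hw⟩ := h r ⟨m, hmK, hr1.le⟩
    exact absurd ((hxmin w ⟨hwK, hwF⟩).trans hw) (not_le.mpr hr2)

/-- Successive minimization of the functionals `⟨·, v⟩`, `v ∈ l`, over `K`. -/
def lexArgmin : List (Profile d) → Set (Profile d) → Set (Profile d)
  | [], K => K
  | v :: l, K => lexArgmin l (argminSet v K)

theorem lexArgmin_subset (l : List (Profile d)) (K : Set (Profile d)) : lexArgmin l K ⊆ K := by
  induction l generalizing K with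
  | nil => exact subset_rfl
  | cons v l ih => exact (ih _).trans fun x hx => hx.1

theorem lexArgmin_nonempty (l : List (Profile d)) {K : Set (Profile d)} (hK : IsCompact K)
    (hne : K.Nonempty) : (lexArgmin l K).Nonempty := by
  induction l generalizing K with
  | nil => exact hne
  | cons v l ih => exact ih (isCompact_argminSet v hK) (argminSet_nonempty v hK hne)

theorem inner_eq_of_mem_lexArgmin {l : List (Profile d)} {K : Set (Profile d)} {x y : Profile d}
    (hx : x ∈ lexArgmin l K) (hy : y ∈ lexArgmin l K) {v : Profile d} (hv : v ∈ l) :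
    (inner ℝ x v : ℝ) = inner ℝ y v := by
  induction l generalizing K with
  | nil => simp at hv
  | cons w l ih =>
    rcases List.mem_cons.mp hv with rfl | hv
    · have hx' := lexArgmin_subset l _ hx
      have hy' := lexArgmin_subset l _ hy
      exact le_antisymm (hx'.2 y hy'.1) (hy'.2 x hx'.1)
    · exact ih hx hy hv

theorem measurableSet_lexArgmin_inter (l : List (Profile d)) {K : Ω → Set (Profile d)}
    (hK : ∀ ω, IsCompact (K ω)) (hne : ∀ ω, (K ω).Nonempty)
    (hmeas : ∀ F : Set (Profile d), IsClosed F → MeasurableSet {ω | (K ω ∩ F).Nonempty})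
    {F : Set (Profile d)} (hF : IsClosed F) :
    MeasurableSet {ω | (lexArgmin l (K ω) ∩ F).Nonempty} := by
  induction l generalizing K F with
  | nil => exact hmeas F hF
  | cons v l ih =>
    refine ih (fun ω => isCompact_argminSet v (hK ω))
      (fun ω => argminSet_nonempty v (hK ω) (hne ω)) (fun G hG => ?_) hF
    have hle (r : ℚ) : IsClosed {x : Profile d | (inner ℝ x v : ℝ) ≤ r} :=
      isClosed_le (by fun_prop) (by fun_prop)
    simp only [argminSet_inter_nonempty_iff v (hK _) (hne _) hG]
    exact measurableSet_setOfPred.mpr (Measurable.forall fun r =>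
      (measurableSet_setOfPred.mp (hmeas _ (hle r))).imp
        (measurableSet_setOfPred.mp (hmeas _ (hG.inter (hle r)))))

/-- A compact set disjoint from the closed `F` stays at positive distance from it, so hitting `F` is
a countable intersection of events for open thickenings. -/
theorem MeasurableMultifunction.measurableSet_inter_isClosed {R : Ω → CompactSets d}
    (hR : MeasurableMultifunction R) {F : Set (Profile d)} (hF : IsClosed F) :
    MeasurableSet {ω | ((R ω : Set (Profile d)) ∩ F).Nonempty} := by
  have key : ∀ ω, ((R ω : Set (Profile d)) ∩ F).Nonempty ↔
      ∀ n : ℕ, ((R ω : Set (Profile d)) ∩ Metric.thickening (1 / ((n : ℝ) + 1)) F).Nonempty := by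
    intro ω
    constructor
    · rintro ⟨x, hx, hxF⟩ n
      exact ⟨x, hx, Metric.self_subset_thickening Nat.one_div_pos_of_nat F hxF⟩
    · intro h
      by_contra hne
      have hdisj : Disjoint (R ω : Set (Profile d)) F :=
        Set.disjoint_iff_inter_eq_empty.mpr (Set.not_nonempty_iff_eq_empty.mp hne)
      obtain ⟨δ, hδ, hd⟩ := hdisj.exists_thickenings (R ω).isCompact hF
      obtain ⟨n, hn⟩ := exists_nat_one_div_lt hδ
      obtain ⟨x, hx, hxF⟩ := h n
      exact Set.disjoint_left.mp hd (Metric.self_subset_thickening hδ _ hx)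
        (Metric.thickening_mono hn.le F hxF)
  simp only [key]
  exact measurableSet_setOfPred.mpr (Measurable.forall fun n =>
    measurableSet_setOfPred.mp (hR _ Metric.isOpen_thickening))

theorem MeasurableMultifunction.exists_measurable_argmin {R : Ω → CompactSets d}
    (hR : MeasurableMultifunction R) (z : Profile d) :
    ∃ X : Ω → Profile d, Measurable X ∧ ∀ ω, X ω ∈ argminSet z (R ω : Set (Profile d)) := by
  -- Minimizing along `z` first keeps the point in the argmin; the coordinate vectors then break
  -- ties until a single point remains.
  set l : List (Profile d) := z :: List.ofFn (fun i : Fin d => EuclideanSpace.single i (1 : ℝ))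
    with hl
  choose X hX using fun ω => lexArgmin_nonempty l (R ω).isCompact (R ω).nonempty
  have huniq : ∀ ω, ∀ y ∈ lexArgmin l (R ω : Set (Profile d)), y = X ω := by
    intro ω y hy
    ext i
    have := inner_eq_of_mem_lexArgmin hy (hX ω) (v := EuclideanSpace.single i (1 : ℝ))
      (by simp [hl])
    simpa [EuclideanSpace.inner_single_right] using this
  refine ⟨X, measurable_of_isClosed fun F hF => ?_, fun ω => lexArgmin_subset _ _ (hX ω)⟩
  have : X ⁻¹' F = {ω | (lexArgmin l (R ω : Set (Profile d)) ∩ F).Nonempty} := by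
    ext ω
    refine ⟨fun h => ⟨X ω, hX ω, h⟩, ?_⟩
    rintro ⟨y, hy, hyF⟩
    rwa [huniq ω y hy] at hyF
  rw [this]
  exact measurableSet_lexArgmin_inter l (fun ω => (R ω).isCompact) (fun ω => (R ω).nonempty)
    (fun G hG => hR.measurableSet_inter_isClosed hG) hF

end ArgminSelection

/-! ### Lipschitz bounds and measurability of the user cost -/

section UserCost

variable {d : ℕ}

theorem userCost_eq_of_mem_argminSet {z x : Profile d} {C : Set (Profile d)}
    (hx : x ∈ argminSet z C) : userCost z C = inner ℝ x z := by
  have : IsLeast ((fun q : Profile d => (inner ℝ q z : ℝ)) '' C) (inner ℝ x z) :=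
    ⟨⟨x, hx.1, rfl⟩, by rintro _ ⟨y, hy, rfl⟩; exact hx.2 y hy⟩
  exact this.csInf_eq

theorem norm_le_setNorm {C : CompactSets d} {x : Profile d} (hx : x ∈ (C : Set (Profile d))) :
    ‖x‖ ≤ setNorm C :=
  le_csSup (C.isCompact.image continuous_norm).bddAbove ⟨x, hx, rfl⟩

theorem exists_norm_eq_setNorm (C : CompactSets d) :
    ∃ x ∈ (C : Set (Profile d)), ‖x‖ = setNorm C :=
  (C.isCompact.image continuous_norm).sSup_mem (C.nonempty.image _)

theorem setNorm_nonneg (C : CompactSets d) : 0 ≤ setNorm C := by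
  obtain ⟨x, -, hx⟩ := exists_norm_eq_setNorm C
  exact hx ▸ norm_nonneg x

theorem exists_mem_argminSet (z : Profile d) (C : CompactSets d) :
    ∃ x, x ∈ argminSet z (C : Set (Profile d)) :=
  argminSet_nonempty z C.isCompact C.nonempty

theorem userCost_sub_le (z w : Profile d) (C : CompactSets d) :
    userCost z (C : Set (Profile d)) - userCost w (C : Set (Profile d))
      ≤ setNorm C * ‖z - w‖ := by
  obtain ⟨x, hx⟩ := exists_mem_argminSet z C
  obtain ⟨y, hy⟩ := exists_mem_argminSet w C
  rw [userCost_eq_of_mem_argminSet hx, userCost_eq_of_mem_argminSet hy]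
  -- The minimizer at `w` is a competitor at `z`.
  calc (inner ℝ x z : ℝ) - inner ℝ y w ≤ inner ℝ y z - inner ℝ y w := by
        linarith [hx.2 y hy.1]
    _ = inner ℝ y (z - w) := (inner_sub_right _ _ _).symm
    _ ≤ ‖y‖ * ‖z - w‖ := real_inner_le_norm _ _
    _ ≤ setNorm C * ‖z - w‖ :=
        mul_le_mul_of_nonneg_right (norm_le_setNorm hy.1) (norm_nonneg _)

theorem abs_userCost_sub_le (z w : Profile d) (C : CompactSets d) :
    |userCost z (C : Set (Profile d)) - userCost w (C : Set (Profile d))|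
      ≤ setNorm C * ‖z - w‖ := by
  refine abs_sub_le_iff.mpr ⟨userCost_sub_le z w C, ?_⟩
  rw [norm_sub_rev]
  exact userCost_sub_le w z C

theorem measurable_userCost (z : Profile d) :
    Measurable fun C : CompactSets d => userCost z (C : Set (Profile d)) := by
  refine measurable_of_Iio fun r => MeasurableSpace.measurableSet_generateFrom
    ⟨{x | (inner ℝ x z : ℝ) < r}, isOpen_lt (by fun_prop) (by fun_prop), ?_⟩
  ext C
  obtain ⟨x, hx⟩ := exists_mem_argminSet z C
  simp only [Set.mem_preimage, Set.mem_Iio, userCost_eq_of_mem_argminSet hx, Set.mem_ofPred_eq]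
  exact ⟨fun h => ⟨x, hx.1, h⟩, fun ⟨y, hy, h⟩ => (hx.2 y hy).trans_lt h⟩

theorem measurable_setNorm : Measurable (setNorm : CompactSets d → ℝ) := by
  refine measurable_of_Ioi fun r => MeasurableSpace.measurableSet_generateFrom
    ⟨{x | r < ‖x‖}, isOpen_lt (by fun_prop) (by fun_prop), ?_⟩
  ext C
  obtain ⟨x, hx, hxn⟩ := exists_norm_eq_setNorm C
  simp only [Set.mem_preimage, Set.mem_Ioi, Set.mem_ofPred_eq]
  exact ⟨fun h => ⟨x, hx, h.trans_eq hxn.symm⟩, fun ⟨y, hy, h⟩ => lt_of_lt_of_le h (norm_le_setNorm hy)⟩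

theorem abs_empiricalCost_sub_le (n : ℕ) (R : ℕ → CompactSets d) (z w : Profile d) :
    |empiricalCost n R z - empiricalCost n R w|
      ≤ ((∑ i ∈ Finset.range n, setNorm (R i)) / n) * ‖z - w‖ := by
  rw [empiricalCost, empiricalCost, ← mul_sub, ← Finset.sum_sub_distrib, abs_mul,
    abs_of_nonneg (by positivity), one_div, div_eq_inv_mul, mul_assoc, Finset.sum_mul]
  gcongr
  exact (Finset.abs_sum_le_sum_abs _ _).trans
    (Finset.sum_le_sum fun i _ => abs_userCost_sub_le z w (R i))

end UserCost

/-! ### The mean-field cost as an expectation -/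

section MeanField

variable {d : ℕ} {Ω : Type*} [MeasurableSpace Ω] {P : Measure Ω} {R : Ω → CompactSets d}

theorem exists_isSelection_argmin (hR : MeasurableMultifunction R)
    (hint : Integrable (fun ω => setNorm (R ω)) P) (z : Profile d) :
    ∃ X, IsSelection P R X ∧ ∀ ω, X ω ∈ argminSet z (R ω : Set (Profile d)) := by
  obtain ⟨X, hXm, hX⟩ := hR.exists_measurable_argmin z
  refine ⟨X, ⟨hXm, ?_, .of_forall fun ω => (hX ω).1⟩, hX⟩
  exact hint.mono' hXm.aestronglyMeasurable (.of_forall fun ω => norm_le_setNorm (hX ω).1)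

theorem integrable_userCost (hR : MeasurableMultifunction R)
    (hint : Integrable (fun ω => setNorm (R ω)) P) (z : Profile d) :
    Integrable (fun ω => userCost z (R ω : Set (Profile d))) P := by
  obtain ⟨X, hX, hXz⟩ := exists_isSelection_argmin hR hint z
  simpa only [userCost_eq_of_mem_argminSet (hXz _)] using hX.2.1.inner_const z

/-- A pointwise minimizer beats every other selection almost surely, hence in expectation; this
interchanges minimum and expectation. -/
theorem integral_mem_argminSet_expectedSet {X : Ω → Profile d} {z : Profile d}
    (hX : IsSelection P R X) (hXz : ∀ ω, X ω ∈ argminSet z (R ω : Set (Profile d))) :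
    ∫ ω, X ω ∂P ∈ argminSet z (expectedSet P R) := by
  have hinner {Y : Ω → Profile d} (hY : Integrable Y P) :
      (inner ℝ (∫ ω, Y ω ∂P) z : ℝ) = ∫ ω, inner ℝ (Y ω) z ∂P := by
    rw [real_inner_comm, ← integral_inner hY]
    simp only [real_inner_comm]
  refine ⟨⟨X, hX, rfl⟩, ?_⟩
  rintro _ ⟨Y, hY, rfl⟩
  rw [hinner hX.2.1, hinner hY.2.1]
  refine integral_mono_ae (hX.2.1.inner_const z) (hY.2.1.inner_const z) ?_
  filter_upwards [hY.2.2] with ω hω using (hXz ω).2 _ hω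

theorem optimalProfiles_nonempty (hR : MeasurableMultifunction R)
    (hint : Integrable (fun ω => setNorm (R ω)) P) (z : Profile d) :
    (optimalProfiles P R z).Nonempty := by
  obtain ⟨X, hX, hXz⟩ := exists_isSelection_argmin hR hint z
  have h := integral_mem_argminSet_expectedSet hX hXz
  exact ⟨_, h.1, (userCost_eq_of_mem_argminSet h).symm⟩

theorem meanFieldCost_eq_integral (hR : MeasurableMultifunction R)
    (hint : Integrable (fun ω => setNorm (R ω)) P) (z : Profile d) :
    meanFieldCost P R z = ∫ ω, userCost z (R ω : Set (Profile d)) ∂P := by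
  obtain ⟨X, hX, hXz⟩ := exists_isSelection_argmin hR hint z
  rw [meanFieldCost, userCost_eq_of_mem_argminSet (integral_mem_argminSet_expectedSet hX hXz),
    real_inner_comm, ← integral_inner hX.2.1]
  simp only [userCost_eq_of_mem_argminSet (hXz _), real_inner_comm]

theorem abs_meanFieldCost_sub_le (hR : MeasurableMultifunction R)
    (hint : Integrable (fun ω => setNorm (R ω)) P) (z w : Profile d) :
    |meanFieldCost P R z - meanFieldCost P R w| ≤ (∫ ω, setNorm (R ω) ∂P) * ‖z - w‖ := by
  rw [meanFieldCost_eq_integral hR hint, meanFieldCost_eq_integral hR hint,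
    ← integral_sub (integrable_userCost hR hint z) (integrable_userCost hR hint w),
    ← integral_mul_const]
  exact norm_integral_le_of_norm_le (G := ℝ) (hint.mul_const _)
    (.of_forall fun ω => abs_userCost_sub_le z w (R ω))

theorem continuous_meanFieldCost (hR : MeasurableMultifunction R)
    (hint : Integrable (fun ω => setNorm (R ω)) P) : Continuous (meanFieldCost P R) := by
  refine (LipschitzWith.of_dist_le_mul (K := (∫ ω, setNorm (R ω) ∂P).toNNReal)
    fun z w => ?_).continuous
  rw [Real.dist_eq, dist_eq_norm,
    Real.coe_toNNReal _ (integral_nonneg fun ω => setNorm_nonneg (R ω))]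
  exact abs_meanFieldCost_sub_le hR hint z w

end MeanField

/-! ### Compactness and non-emptiness of the price set -/

section PriceSet

variable {d : ℕ} {ρ : Profile d → ℝ}

theorem isClosed_priceSet (ρ : Profile d → ℝ) : IsClosed (priceSet ρ) := by
  have : priceSet ρ = ⋂ q : Profile d, {z | (inner ℝ z q : ℝ) ≤ ρ q} := by
    ext z; simp [priceSet]
  rw [this]
  exact isClosed_iInter fun q => isClosed_le (by fun_prop) (by fun_prop)

theorem isCompact_priceSet (ρ : Profile d → ℝ) : IsCompact (priceSet ρ) := by
  refine Metric.isCompact_of_isClosed_isBounded (isClosed_priceSet ρ) ?_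
  let e (i : Fin d) : Profile d := EuclideanSpace.single i (1 : ℝ)
  refine isBounded_iff_forall_norm_le.mpr
    ⟨∑ i, (|ρ (e i)| + |ρ (-e i)|), fun z hz => ?_⟩
  -- Testing the constraint at `e i` and `-e i` bounds each coordinate from both sides.
  have hcoord (i : Fin d) : |z i| ≤ |ρ (e i)| + |ρ (-e i)| := by
    have h1 := hz (e i)
    have h2 := hz (-e i)
    rw [inner_neg_right] at h2
    simp only [e, EuclideanSpace.inner_single_right] at h1 h2
    simp only [conj_trivial, one_mul] at h1 h2
    rw [abs_le]
    constructor <;> linarith [le_abs_self (ρ (e i)), le_abs_self (ρ (-e i)),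
      abs_nonneg (ρ (e i)), abs_nonneg (ρ (-e i)), h1, h2]
  calc ‖z‖ = ‖∑ i, z i • e i‖ := by
        congr 1
        ext j
        simp [e, Pi.single_apply]
    _ ≤ ∑ i, ‖z i • e i‖ := norm_sum_le _ _
    _ = ∑ i, |z i| := by simp [e, norm_smul]
    _ ≤ _ := Finset.sum_le_sum fun i _ => hcoord i

theorem priceSet_nonempty (hconv : ConvexOn ℝ Set.univ ρ)
    (hhom : ∀ α : ℝ, 0 ≤ α → ∀ q : Profile d, ρ (α • q) = α * ρ q) : (priceSet ρ).Nonempty := by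
  have hadd (x y : Profile d) : ρ (x + y) ≤ ρ x + ρ y := by
    have h : ρ ((1 / 2 : ℝ) • x + (1 / 2 : ℝ) • y) ≤ (1 / 2 : ℝ) • ρ x + (1 / 2 : ℝ) • ρ y :=
      hconv.2 (Set.mem_univ x) (Set.mem_univ y) (by norm_num) (by norm_num) (by norm_num)
    rw [← smul_add, hhom _ (by norm_num)] at h
    simp only [smul_eq_mul] at h
    linarith
  have hzero : ρ 0 = 0 := by simpa using hhom 0 le_rfl 0
  -- Hahn–Banach: the zero functional on the trivial subspace extends to a linear functional
  -- dominated by `ρ`, whose Riesz vector is a price.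
  obtain ⟨g, -, hg⟩ := exists_extension_of_le_sublinear
    (⟨⊥, 0⟩ : Profile d →ₗ.[ℝ] ℝ) ρ (fun c hc x => hhom c hc.le x) hadd
    (fun x => by
      have : (x : Profile d) = 0 := (Submodule.mem_bot ℝ).mp x.2
      simp [this, hzero])
  refine ⟨(InnerProductSpace.toDual ℝ (Profile d)).symm (LinearMap.toContinuousLinearMap g),
    fun q => ?_⟩
  rw [InnerProductSpace.toDual_symm_apply]
  exact hg q

end PriceSet

/-! ### Uniform convergence and convergence of maximal values -/

section Convergence

theorem tendstoUniformlyOn_of_tendsto_on_dense {E : Type*} [PseudoMetricSpace E] {K s : Set E}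
    (hK : IsCompact K) (hs : Dense s) {f : ℕ → E → ℝ} {g : E → ℝ} {L : ℕ → ℝ} {M C : ℝ}
    (hL : Tendsto L atTop (𝓝 M)) (hf : ∀ n z w, |f n z - f n w| ≤ L n * dist z w)
    (hg : ∀ z w, |g z - g w| ≤ C * dist z w)
    (hfg : ∀ z ∈ s, Tendsto (fun n => f n z) atTop (𝓝 (g z))) :
    TendstoUniformlyOn f g atTop K := by
  rw [Metric.tendstoUniformlyOn_iff]
  intro ε hε
  -- `B` eventually dominates the Lipschitz constants of `f n` and `g` together; with `B * δ = ε /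
  -- 3`, moving to a net point costs less than `ε / 3`. Net points need not lie in `K`.
  set B : ℝ := |M| + 1 + |C| with hB
  have hBpos : 0 < B := by positivity
  set δ : ℝ := ε / (3 * B) with hδ
  have hδpos : 0 < δ := by positivity
  obtain ⟨t, hts, htf, htK⟩ := hK.elim_finite_subcover_image
    (b := s) (c := fun x => Metric.ball x δ) (fun _ _ => Metric.isOpen_ball) (fun x _ => by
      obtain ⟨y, hy, hxy⟩ := hs.exists_dist_lt x hδpos
      exact Set.mem_biUnion hy hxy)
  have h1 : ∀ᶠ n in atTop, ∀ y ∈ t, |f n y - g y| < ε / 3 := by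
    rw [htf.eventually_all]
    intro y hy
    exact (Metric.tendsto_nhds.mp (hfg y (hts hy))) (ε / 3) (by positivity)
  have h2 : ∀ᶠ n in atTop, L n < |M| + 1 :=
    hL.eventually_lt_const (by linarith [le_abs_self M])
  filter_upwards [h1, h2] with n hn hLn x hx
  obtain ⟨y, hyt, hxy⟩ := Set.mem_iUnion₂.mp (htK hx)
  rw [Metric.mem_ball] at hxy
  have hBδ : B * δ = ε / 3 := by rw [hδ]; field_simp
  have a1 : |f n x - f n y| + |g x - g y| ≤ B * dist x y := by
    calc _ ≤ L n * dist x y + C * dist x y := add_le_add (hf n x y) (hg x y)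
      _ = (L n + C) * dist x y := by ring
      _ ≤ B * dist x y := by
        gcongr
        exact add_le_add hLn.le (le_abs_self C)
  have a2 : B * dist x y < ε / 3 := hBδ ▸ mul_lt_mul_of_pos_left hxy hBpos
  have a3 := hn y hyt
  rw [Real.dist_eq]
  rw [abs_lt] at a3 ⊢
  have := abs_le.mp (le_refl |f n x - f n y|)
  have := abs_le.mp (le_refl |g x - g y|)
  have := abs_nonneg (f n x - f n y)
  have := abs_nonneg (g x - g y)
  constructor <;> linarith

/-- For a maximizer `y` of `g`, eventually `g y - ε/2 < f n y ≤ f n (x n) < g (x n) + ε/2`. The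
points `x n` themselves need not converge. -/
theorem tendsto_of_isMaxOn_of_tendstoUniformlyOn {E : Type*} {K : Set E} {f : ℕ → E → ℝ}
    {g : E → ℝ} {m : ℝ} (hfg : TendstoUniformlyOn f g atTop K) (hm : IsGreatest (g '' K) m)
    {x : ℕ → E} (hx : ∀ᶠ n in atTop, x n ∈ K ∧ IsMaxOn (f n) K (x n)) :
    Tendsto (fun n => g (x n)) atTop (𝓝 m) := by
  obtain ⟨⟨y, hy, rfl⟩, hub⟩ := hm
  rw [Metric.tendsto_nhds]
  intro ε hε
  rw [Metric.tendstoUniformlyOn_iff] at hfg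
  filter_upwards [hfg (ε / 2) (half_pos hε), hx] with n hn hxn
  have h1 := hn _ hxn.1
  have h2 := hn _ hy
  have h3 : f n y ≤ f n (x n) := hxn.2 hy
  have h4 : g (x n) ≤ g y := hub ⟨_, hxn.1, rfl⟩
  rw [Real.dist_eq, abs_lt] at *
  constructor <;> linarith

end Convergence

/-! ### Strong law for the empirical objective -/

section StrongLaw

variable {d : ℕ} {Ω₀ : Type*} [MeasurableSpace Ω₀] {P : Measure Ω₀}
  {R : Ω₀ → CompactSets d} {Ω : Type*} [MeasurableSpace Ω] {μ : Measure Ω}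
  {Rs : ℕ → Ω → CompactSets d}

theorem ae_tendsto_average_of_identDistrib (hindep : iIndepFun Rs μ)
    (hident : ∀ i, IdentDistrib (Rs i) R μ P) {φ : CompactSets d → ℝ} (hφ : Measurable φ)
    (hint : Integrable (fun ω => φ (R ω)) P) :
    ∀ᵐ ω ∂μ, Tendsto (fun n : ℕ => (∑ i ∈ Finset.range n, φ (Rs i ω)) / n) atTop
      (𝓝 (∫ ω, φ (R ω) ∂P)) := by
  have hid (i : ℕ) : IdentDistrib (φ ∘ Rs i) (φ ∘ R) μ P := (hident i).comp hφ
  have h := strong_law_ae_real (fun i => φ ∘ Rs i) ((hid 0).integrable_iff.mpr hint)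
    (fun i j hij => (hindep.indepFun hij).comp hφ hφ) (fun i => (hid i).trans (hid 0).symm)
  rw [(hid 0).integral_eq] at h
  exact h

theorem ae_tendsto_empiricalCost (hindep : iIndepFun Rs μ)
    (hident : ∀ i, IdentDistrib (Rs i) R μ P) (hR : MeasurableMultifunction R)
    (hint : Integrable (fun ω => setNorm (R ω)) P) (z : Profile d) :
    ∀ᵐ ω ∂μ, Tendsto (fun n : ℕ => empiricalCost n (fun i => Rs i ω) z) atTop
      (𝓝 (meanFieldCost P R z)) := by
  rw [meanFieldCost_eq_integral hR hint]
  filter_upwards [ae_tendsto_average_of_identDistrib hindep hident (measurable_userCost z)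
    (integrable_userCost hR hint z)] with ω hω
  simpa only [empiricalCost, one_div, div_eq_inv_mul, mul_one] using hω

theorem ae_tendstoUniformlyOn_empirical_objective (hindep : iIndepFun Rs μ)
    (hident : ∀ i, IdentDistrib (Rs i) R μ P) (hR : MeasurableMultifunction R)
    (hint : Integrable (fun ω => setNorm (R ω)) P) {Q : ℕ → Ω → Profile d} {q₀ : Profile d}
    (hQ : ∀ᵐ ω ∂μ, Tendsto (fun n => Q n ω) atTop (𝓝 q₀)) {K : Set (Profile d)}
    (hK : IsCompact K) :
    ∀ᵐ ω ∂μ, TendstoUniformlyOn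
      (fun n z => empiricalCost n (fun i => Rs i ω) z - inner ℝ z (Q n ω))
      (fun z => meanFieldCost P R z - inner ℝ z q₀) atTop K := by
  obtain ⟨s, hsc, hsd⟩ := TopologicalSpace.exists_countable_dense (Profile d)
  have hlin (q z w : Profile d) : |(inner ℝ z q : ℝ) - inner ℝ w q| ≤ ‖q‖ * ‖z - w‖ := by
    rw [← inner_sub_left, mul_comm]
    exact abs_real_inner_le_norm _ _
  have hsub (a b c e : ℝ) : |(a - b) - (c - e)| ≤ |a - c| + |b - e| := by
    rw [sub_sub_sub_comm]
    exact abs_sub _ _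
  -- Countability of `s` yields one null set outside which convergence holds at all its points.
  filter_upwards [hQ, ae_tendsto_average_of_identDistrib hindep hident measurable_setNorm hint,
    (ae_ball_iff hsc).mpr fun z _ => ae_tendsto_empiricalCost hindep hident hR hint z]
    with ω hQω hnorm hpt
  refine tendstoUniformlyOn_of_tendsto_on_dense hK hsd (hnorm.add hQω.norm)
    (C := (∫ ω, setNorm (R ω) ∂P) + ‖q₀‖) (fun n z w => ?_) (fun z w => ?_) (fun z hz => ?_)
  · rw [dist_eq_norm, add_mul]
    exact (hsub _ _ _ _).trans (add_le_add (abs_empiricalCost_sub_le _ _ _ _) (hlin _ _ _))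
  · rw [dist_eq_norm, add_mul]
    exact (hsub _ _ _ _).trans (add_le_add (abs_meanFieldCost_sub_le hR hint _ _) (hlin _ _ _))
  · exact (hpt z hz).sub (tendsto_const_nhds.inner hQω)

end StrongLaw

theorem isGreatest_directCost {d : ℕ} {Ω : Type*} [MeasurableSpace Ω] {P : Measure Ω}
    {R : Ω → CompactSets d} (hR : MeasurableMultifunction R)
    (hint : Integrable (fun ω => setNorm (R ω)) P) {ρ : Profile d → ℝ}
    (hconv : ConvexOn ℝ Set.univ ρ)
    (hhom : ∀ α : ℝ, 0 ≤ α → ∀ q : Profile d, ρ (α • q) = α * ρ q) (q₀ : Profile d) :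
    IsGreatest ((fun z : Profile d => meanFieldCost P R z - inner ℝ z q₀) '' priceSet ρ)
      (directCost P R ρ q₀) := by
  have hcont : Continuous fun z : Profile d => meanFieldCost P R z - inner ℝ z q₀ :=
    (continuous_meanFieldCost hR hint).sub (by fun_prop)
  exact ((isCompact_priceSet ρ).image hcont).isGreatest_sSup
    ((priceSet_nonempty hconv hhom).image _)

theorem suboptimalityGap_eq {d : ℕ} {Ω : Type*} [MeasurableSpace Ω] {P : Measure Ω}
    {R : Ω → CompactSets d} {ρ : Profile d → ℝ} {q₀ z q : Profile d}
    (hq : q ∈ optimalProfiles P R z) :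
    suboptimalityGap P R ρ q₀ z q
      = (meanFieldCost P R z - inner ℝ z q₀) - directCost P R ρ q₀ := by
  rw [suboptimalityGap, inner_sub_right, real_inner_comm q z, hq.2, meanFieldCost]

end DemandResponse

theorem mainTheorem3 {d : ℕ}
    -- the distribution of the indifference sets: a measurable multifunction on a non-atomic space
    {Ω₀ : Type*} [MeasurableSpace Ω₀] (P : Measure Ω₀) [IsProbabilityMeasure P]
    (hP : DemandResponse.NonAtomic P)
    (R : Ω₀ → DemandResponse.CompactSets d)
    (hR : DemandResponse.MeasurableMultifunction R)
    (hR_int : Integrable (fun ω => DemandResponse.setNorm (R ω)) P)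
    -- the users' indifference sets: an i.i.d. sequence with that distribution
    {Ω : Type*} [MeasurableSpace Ω] (μ : Measure Ω) [IsProbabilityMeasure μ]
    (Rs : ℕ → Ω → DemandResponse.CompactSets d)
    (hRs_meas : ∀ i, DemandResponse.MeasurableMultifunction (Rs i))
    (hRs_indep : iIndepFun Rs μ)
    (hRs_ident : ∀ i, IdentDistrib (Rs i) R μ P)
    -- the grid cost of net demand
    (ρ : DemandResponse.Profile d → ℝ) (hρ_convex : ConvexOn ℝ Set.univ ρ)
    (hρ_homog : ∀ α : ℝ, 0 ≤ α → ∀ q : DemandResponse.Profile d, ρ (α • q) = α * ρ q)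
    -- renewable production, scaling with the system size
    (Q₀ : ℕ → Ω → DemandResponse.Profile d) (q₀ : DemandResponse.Profile d)
    (hQ₀ : ∀ᵐ ω ∂μ, Tendsto (fun n : ℕ => (1 / (n : ℝ)) • Q₀ n ω) atTop (𝓝 q₀)) :
    -- the quantities that define the gap exist: `R^DM` is a maximum, and `Θ(z)` is non-empty
    IsGreatest ((fun z : DemandResponse.Profile d =>
        DemandResponse.meanFieldCost P R z - inner ℝ z q₀) '' DemandResponse.priceSet ρ)
      (DemandResponse.directCost P R ρ q₀) ∧
    (∀ z : DemandResponse.Profile d, (DemandResponse.optimalProfiles P R z).Nonempty) ∧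
    -- the gap of empirical maximizers vanishes almost surely
    ∀ zhat : ℕ → Ω → DemandResponse.Profile d,
      (∀ᵐ ω ∂μ, ∀ n : ℕ, 1 ≤ n →
        zhat n ω ∈ DemandResponse.priceSet ρ ∧
        IsMaxOn (fun z : DemandResponse.Profile d =>
            DemandResponse.empiricalCost n (fun i => Rs i ω) z
              - inner ℝ z ((1 / (n : ℝ)) • Q₀ n ω))
          (DemandResponse.priceSet ρ) (zhat n ω)) →
      ∀ qbar : ℕ → Ω → DemandResponse.Profile d,
        (∀ᵐ ω ∂μ, ∀ n : ℕ, 1 ≤ n →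
          qbar n ω ∈ DemandResponse.optimalProfiles P R (zhat n ω)) →
        ∀ᵐ ω ∂μ, Tendsto
          (fun n : ℕ => DemandResponse.suboptimalityGap P R ρ q₀ (zhat n ω) (qbar n ω))
          atTop (𝓝 0) := by
  have hgreat := DemandResponse.isGreatest_directCost hR hR_int hρ_convex hρ_homog q₀
  refine ⟨hgreat, DemandResponse.optimalProfiles_nonempty hR hR_int, fun zhat hz qbar hq => ?_⟩
  filter_upwards [hz, hq, DemandResponse.ae_tendstoUniformlyOn_empirical_objective hRs_indep
    hRs_ident hR hR_int hQ₀ (DemandResponse.isCompact_priceSet ρ)] with ω hzω hqω hunif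
  -- Optimality is only given for `n ≥ 1`, which suffices for the limit.
  have hlim := (DemandResponse.tendsto_of_isMaxOn_of_tendstoUniformlyOn hunif hgreat
    ((eventually_ge_atTop 1).mono hzω)).sub_const (DemandResponse.directCost P R ρ q₀)
  rw [sub_self] at hlim
  refine hlim.congr' ?_
  filter_upwards [eventually_ge_atTop 1] with n hn
  exact (DemandResponse.suboptimalityGap_eq (hqω n hn)).symm
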